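/- Let $K$ be a field of characteristic zero (for instance $\mathbb{C}$), let $(\mathfrak{g}^i)_{i\in I}$ be a finite family of finite-dimensional semisimple Lie algebras over $K$, and let each $\mathfrak{g}^i=\bigoplus_{m=-2}^{2}\mathfrak{g}^i_m$ be $|2|$-graded: $[\mathfrak{g}^i_m,\mathfrak{g}^i_n]\subseteq\mathfrak{g}^i_{m+n}$, the subalgebra $\mathfrak{g}^i_-=\mathfrak{g}^i_{-2}\oplus\mathfrak{g}^i_{-1}$ is generated by $\mathfrak{g}^i_{-1}$, and every simple ideal of $\mathfrak{g}^i$ meets $\mathfrak{g}^i_{-2}$ nontrivially (for $\mathfrak{g}^i$ simple: $\mathfrak{g}^i_{-2}\neq0$). Let $\mathfrak{g}=\bigoplus_i\mathfrak{g}^i$ with the grading $\mathfrak{g}_m=\bigoplus_i\mathfrak{g}^i_m$, and put $\mathfrak{p}=\bigoplus_{m\ge0}\mathfrak{g}_m$, $\mathfrak{g}^+=\bigoplus_{m\ge1}\mathfrak{g}_m$ and $\mathfrak{g}_-=\bigoplus_{m\ge1}\mathfrak{g}_{-m}\cong\mathfrak{g}/\mathfrak{p}$. Following the usual convention for parabolic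 geometries, $H^1(\mathfrak{g}^+,\mathfrak{g})$ denotes the first cohomology of the complex $\Lambda^n\mathfrak{g}^+\otimes\mathfrak{g}\cong\mathrm{Hom}(\Lambda^n\mathfrak{g}_-,\mathfrak{g})$ (where $\mathfrak{g}^+\cong(\mathfrak{g}_-)^*$ by the Killing form), that is, the Lie algebra cohomology of $\mathfrak{g}_-$ with values in $\mathfrak{g}$; a class has homogeneity $\ell$ if it is represented by a cocycle that maps $\mathfrak{g}_m$ into $\mathfrak{g}_{m+\ell}$ for all $m$. The same notation is used for each $\mathfrak{g}^i$. Then, for every $\ell\neq-1$, and in particular in homogeneity $\ell=0$, the natural map (extension of cochains by zero) $$\bigoplus_i H^1\big((\mathfrak{g}^i)^+,\mathfrak{g}^i\big)_\ell\longrightarrow H^1(\mathfrak{g}^+,\mathfrak{g})_\ell$$ is an isomorphism. More precisely, for $i\neq j$ and $x\in\mathfrak{g}^i_{-2}$, $z\in\mathfrak{g}^j_1$, the cochain $x\otimes z\colon y\mapsto\kappa^j(z,y_j)\,x$ ($\kappa^j$ the Killing form of $\mathfrak{g}^j$, $y_j$ the component of $y$ in $\mathfrak{g}^j$) is a cocycle,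 its class has homogeneity $-1$, and these natural maps give an isomorphism $$\bigoplus_i H^1\big((\mathfrak{g}^i)^+,\mathfrak{g}^i\big)\ \oplus\ \bigoplus_{i\neq j}\mathfrak{g}^i_{-2}\otimes\mathfrak{g}^j_{1}\ \xrightarrow{\ \cong\ }\ H^1(\mathfrak{g}^+,\mathfrak{g}).$$ The same holds if $H^1(\mathfrak{g}^+,\mathfrak{g})$ is read literally as the Lie algebra cohomology of the subalgebra $\mathfrak{g}^+$ with values in $\mathfrak{g}$, and likewise for each $\mathfrak{g}^i$; then the cross terms are $\mathfrak{g}^i_2\otimes\mathfrak{g}^j_{-1}$ and have homogeneity $+1$, and the isomorphism of homogeneous parts holds for every $\ell\ne1$, in particular for $\ell=0$. -/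

import Mathlib

open scoped TensorProduct DirectSum

noncomputable section

namespace LieHOne

open LieModule.Cohomology

section Cohomology

variable (R L M : Type*) [CommRing R] [LieRing L] [LieAlgebra R L]
  [AddCommGroup M] [Module R M] [LieRingModule L M] [LieModule R L M]

/-- The Chevalley–Eilenberg differential in degree zero: `m ↦ (x ↦ ⁅x, m⁆)`. -/
def dZero : M →ₗ[R] oneCochain R L M :=
  LinearMap.flip (LieModule.toEnd R L M : L →ₗ[R] Module.End R M)

/-- The 1-cocycles of `L` with values in `M`. -/
def ZOne : Submodule R (oneCochain R L M) := LinearMap.ker (d₁₂ R L M)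

/-- The 1-coboundaries of `L` with values in `M`. -/
def BOne : Submodule R (oneCochain R L M) := LinearMap.range (dZero R L M)

/-- The first Lie algebra cohomology `H¹(L, M) = Z¹(L, M) / B¹(L, M)`. -/
abbrev HOne : Type _ := ZOne R L M ⧸ (BOne R L M).comap (ZOne R L M).subtype

variable {R L M}

theorem mem_ZOne {f : oneCochain R L M} :
    f ∈ ZOne R L M ↔ ∀ x y : L, ⁅x, f y⁆ - ⁅y, f x⁆ - f ⁅x, y⁆ = 0 := by
  rw [ZOne, LinearMap.mem_ker]
  constructor
  · intro h x y
    rw [← d₁₂_apply_apply, h]; rfl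
  · intro h
    ext x y
    exact h x y

theorem dZero_apply (m : M) (x : L) : dZero R L M m x = ⁅x, m⁆ := rfl

/-- The class in `H¹(L, M)` of a 1-cocycle. -/
def cls (f : oneCochain R L M) (hf : f ∈ ZOne R L M) : HOne R L M :=
  Submodule.Quotient.mk ⟨f, hf⟩

end Cohomology

/-- A `ℤ`-grading of a Lie algebra: `L = ⨁ L_m` with `⁅L_m, L_n⁆ ⊆ L_{m+n}`. -/
structure LieGrading (K L : Type*) [Field K] [LieRing L] [LieAlgebra K L] where
  /-- The graded pieces `L_m`. -/
  piece : ℤ → Submodule K L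
  isInternal : DirectSum.IsInternal piece
  lie_mem : ∀ {m n : ℤ} {x y : L}, x ∈ piece m → y ∈ piece n → ⁅x, y⁆ ∈ piece (m + n)

namespace LieGrading

section Basic

variable {K L : Type*} [Field K] [LieRing L] [LieAlgebra K L] (γ : LieGrading K L)

/-- The subalgebra `⨁_{m ≥ 1} L_{ε m}`, for a sign `ε`. For `ε = 1` it is `L⁺ = ⨁_{m ≥ 1} L_m`,
the nilradical of the parabolic `𝔭 = ⨁_{m ≥ 0} L_m`; for `ε = -1` it is `L_- = ⨁_{m ≥ 1} L_{-m}`,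
which is identified with `L / 𝔭`. -/
def nilPart (ε : ℤˣ) : LieSubalgebra K L where
  __ := ⨆ m : {m : ℤ // 1 ≤ m}, γ.piece (ε * m)
  lie_mem' {x y} hx hy := by
    change x ∈ (⨆ m : {m : ℤ // 1 ≤ m}, γ.piece (ε * m)) at hx
    change y ∈ (⨆ m : {m : ℤ // 1 ≤ m}, γ.piece (ε * m)) at hy
    change ⁅x, y⁆ ∈ (⨆ m : {m : ℤ // 1 ≤ m}, γ.piece (ε * m))
    induction hx using Submodule.iSup_induction' with
    | zero => simp
    | add a b _ _ ha hb => rw [add_lie]; exact add_mem ha hb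
    | mem m a ha =>
      induction hy using Submodule.iSup_induction' with
      | zero => simp
      | add b c _ _ hb hc => rw [lie_add]; exact add_mem hb hc
      | mem n b hb =>
        refine Submodule.mem_iSup_of_mem (⟨m + n, by have := m.2; have := n.2; omega⟩ :
          {m : ℤ // 1 ≤ m}) ?_
        have := γ.lie_mem ha hb
        rwa [← mul_add] at this

theorem mem_nilPart {ε : ℤˣ} {x : L} :
    x ∈ γ.nilPart ε ↔ x ∈ (⨆ m : {m : ℤ // 1 ≤ m}, γ.piece (ε * m)) := Iff.rfl

/-- A grading of a semisimple Lie algebra is a `|k|`-grading if it is concentrated in the degrees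
`-k, …, k`, if the negative part is generated by the piece of degree `-1`, and if every simple
ideal (equivalently, every nonzero ideal) really reaches the degree `-k`, that is, if the grading
that is induced on each simple ideal has the same depth `k`. -/
structure IsKGraded (k : ℕ) : Prop where
  piece_eq_bot : ∀ m : ℤ, (k : ℤ) < |m| → γ.piece m = ⊥
  lieSpan_eq : LieSubalgebra.lieSpan K L (γ.piece (-1) : Set L) = γ.nilPart (-1)
  exists_mem : ∀ I : LieIdeal K L, IsAtom I → ∃ x ∈ I, x ∈ γ.piece (-(k : ℤ)) ∧ x ≠ 0

/-- The homogeneous cocycles of degree (homogeneity) `l` of `γ.nilPart ε` with values in the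
adjoint representation: they send `L_m` to `L_{m+l}`. -/
def homogeneousZOne (ε : ℤˣ) (l : ℤ) : Submodule K (ZOne K (γ.nilPart ε) L) where
  carrier := {f | ∀ (m : ℤ) (x : γ.nilPart ε), (x : L) ∈ γ.piece m → f.1 x ∈ γ.piece (m + l)}
  add_mem' hf hg m x hx := add_mem (hf m x hx) (hg m x hx)
  zero_mem' m _ _ := zero_mem (γ.piece (m + l))
  smul_mem' c _ hf m x hx := Submodule.smul_mem _ c (hf m x hx)

/-- The part of homogeneity `l` of `H¹(γ.nilPart ε, L)`. -/
def homogeneousHOne (ε : ℤˣ) (l : ℤ) : Submodule K (HOne K (γ.nilPart ε) L) :=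
  (γ.homogeneousZOne ε l).map (Submodule.mkQ _)

end Basic

section DirectSum

open DirectSum

variable {K : Type*} [Field K] {ι : Type*} [DecidableEq ι] {g : ι → Type*}
  [∀ i, LieRing (g i)] [∀ i, LieAlgebra K (g i)] (γ : ∀ i, LieGrading K (g i))

/-- The grading of `⨁ i, g i` with `(⨁ i, g i)_m = ⨁ i, (g i)_m`. -/
def directSum : LieGrading K (⨁ i, g i) where
  piece m :=
    { carrier := {x | ∀ i, x i ∈ (γ i).piece m}
      add_mem' := fun hx hy i => add_mem (hx i) (hy i)
      zero_mem' := fun i => zero_mem ((γ i).piece m)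
      smul_mem' := fun c _ hx i => Submodule.smul_mem _ c (hx i) }
  isInternal := by
    rw [DirectSum.isInternal_submodule_iff_iSupIndep_and_iSup_eq_top]
    constructor
    · rw [iSupIndep_def]
      intro m
      rw [Submodule.disjoint_def]
      intro x hx hx'
      ext i
      have h1 := (γ i).isInternal.submodule_iSupIndep m
      rw [Submodule.disjoint_def] at h1
      refine h1 (x i) (hx i) ?_
      have h2 := Submodule.mem_map_of_mem (f := DirectSum.component K ι g i) hx'
      simp only [Submodule.map_iSup] at h2
      refine SetLike.le_def.mp (iSup₂_mono fun n _ => ?_) h2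
      rintro _ ⟨y, hy, rfl⟩
      exact hy i
    · rw [eq_top_iff]
      intro x _
      induction x using DirectSum.induction_on with
      | zero => exact zero_mem _
      | add x y hx hy => exact add_mem (hx trivial) (hy trivial)
      | of i x =>
        have h1 : x ∈ ⨆ m, (γ i).piece m := by
          rw [(γ i).isInternal.submodule_iSup_eq_top]; trivial
        have h2 := Submodule.mem_map_of_mem (f := DirectSum.lof K ι g i) h1
        simp only [Submodule.map_iSup] at h2
        refine SetLike.le_def.mp (iSup_mono fun n => ?_) h2
        rintro _ ⟨y, hy, rfl⟩ j
        rw [DirectSum.lof_eq_of]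
        by_cases hij : j = i
        · subst hij
          rwa [DirectSum.of_eq_same]
        · rw [DirectSum.of_eq_of_ne _ _ _ hij]
          exact zero_mem _
  lie_mem := by
    intro m n x y hx hy i
    rw [DirectSum.bracket_apply]
    exact (γ i).lie_mem (hx i) (hy i)

theorem mem_directSum_piece {m : ℤ} {x : ⨁ i, g i} :
    x ∈ (directSum γ).piece m ↔ ∀ i, x i ∈ (γ i).piece m := Iff.rfl

theorem apply_mem_nilPart {ε : ℤˣ} {x : ⨁ i, g i} (hx : x ∈ (directSum γ).nilPart ε) (i : ι) :
    x i ∈ (γ i).nilPart ε := by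
  rw [mem_nilPart] at hx ⊢
  have h2 := Submodule.mem_map_of_mem (f := DirectSum.component K ι g i) hx
  simp only [Submodule.map_iSup] at h2
  refine SetLike.le_def.mp (iSup_mono fun n => ?_) h2
  rintro _ ⟨y, hy, rfl⟩
  exact hy i

/-- The projection of the nilpotent subalgebra of `⨁ i, g i` to that of `g i`. -/
def nilProj (ε : ℤˣ) (i : ι) : (directSum γ).nilPart ε →ₗ[K] (γ i).nilPart ε where
  toFun x := ⟨(x : ⨁ i, g i) i, apply_mem_nilPart γ x.2 i⟩
  map_add' _ _ := rfl
  map_smul' _ _ := rfl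

/-- Extension by zero of cochains: `f` is sent to `y ↦ f (y_i)`, with values in the summand
`g i`. -/
def extendCochain (ε : ℤˣ) (i : ι) :
    oneCochain K ((γ i).nilPart ε) (g i) →ₗ[K] oneCochain K ((directSum γ).nilPart ε) (⨁ i, g i) :=
  LinearMap.llcomp K _ _ _ (DirectSum.lof K ι g i) ∘ₗ LinearMap.lcomp K (g i) (nilProj γ ε i)

theorem extendCochain_apply (ε : ℤˣ) (i : ι) (f : oneCochain K ((γ i).nilPart ε) (g i))
    (y : (directSum γ).nilPart ε) :
    extendCochain γ ε i f y = DirectSum.of g i (f (nilProj γ ε i y)) := rfl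

theorem lie_of_right (y : ⨁ i, g i) (i : ι) (x : g i) :
    ⁅y, DirectSum.of g i x⁆ = DirectSum.of g i ⁅y i, x⁆ := by
  ext j
  rw [DirectSum.bracket_apply]
  by_cases hij : j = i
  · subst hij
    rw [DirectSum.of_eq_same, DirectSum.of_eq_same]
  · rw [DirectSum.of_eq_of_ne _ _ _ hij, DirectSum.of_eq_of_ne _ _ _ hij, lie_zero]

theorem extendCochain_mem_ZOne (ε : ℤˣ) (i : ι) {f : oneCochain K ((γ i).nilPart ε) (g i)}
    (hf : f ∈ ZOne K ((γ i).nilPart ε) (g i)) :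
    extendCochain γ ε i f ∈ ZOne K ((directSum γ).nilPart ε) (⨁ i, g i) := by
  rw [mem_ZOne] at hf ⊢
  intro x y
  have h := hf (nilProj γ ε i x) (nilProj γ ε i y)
  have hxy : nilProj γ ε i ⁅x, y⁆ = ⁅nilProj γ ε i x, nilProj γ ε i y⁆ := by
    apply Subtype.ext
    exact DirectSum.bracket_apply g (x : ⨁ i, g i) y i
  rw [extendCochain_apply, extendCochain_apply, extendCochain_apply,
    LieSubalgebra.coe_bracket_of_module, LieSubalgebra.coe_bracket_of_module, lie_of_right,
    lie_of_right, ← map_sub, ← map_sub, hxy]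
  refine (congrArg (DirectSum.of g i) h).trans (map_zero _)

theorem extendCochain_mem_BOne (ε : ℤˣ) (i : ι) {f : oneCochain K ((γ i).nilPart ε) (g i)}
    (hf : f ∈ BOne K ((γ i).nilPart ε) (g i)) :
    extendCochain γ ε i f ∈ BOne K ((directSum γ).nilPart ε) (⨁ i, g i) := by
  obtain ⟨m, rfl⟩ := hf
  refine ⟨DirectSum.of g i m, ?_⟩
  refine LinearMap.ext fun x => ?_
  rw [dZero_apply, LieSubalgebra.coe_bracket_of_module, lie_of_right]
  rfl

/-- The natural map `H¹((g i)^ε, g i) → H¹((⨁ i, g i)^ε, ⨁ i, g i)`, extension by zero. -/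
def extendHOne (ε : ℤˣ) (i : ι) :
    HOne K ((γ i).nilPart ε) (g i) →ₗ[K] HOne K ((directSum γ).nilPart ε) (⨁ i, g i) :=
  Submodule.mapQ _ _
    ((extendCochain γ ε i).restrict fun _ hf => extendCochain_mem_ZOne γ ε i hf)
    fun _ hf => extendCochain_mem_BOne γ ε i hf

/-- The natural map `⨁ i, H¹((g i)^ε, g i) → H¹((⨁ i, g i)^ε, ⨁ i, g i)`. -/
def sumHOne (ε : ℤˣ) :
    (⨁ i, HOne K ((γ i).nilPart ε) (g i)) →ₗ[K]
      HOne K ((directSum γ).nilPart ε) (⨁ i, g i) :=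
  DirectSum.toModule K ι _ fun i => extendHOne γ ε i

/-- The cochain `y ↦ κ(z, y_j) x` for `x ∈ g i` and `z ∈ g j`, where `κ` is the Killing form of
`g j`; this is the tensor `x ⊗ z` when `z` is regarded as a linear form by means of `κ`. -/
def crossCochain (ε : ℤˣ) (i j : ι) (x : g i) (z : g j) :
    oneCochain K ((directSum γ).nilPart ε) (⨁ i, g i) :=
  LinearMap.smulRight
    (killingForm K (g j) z ∘ₗ ((γ j).nilPart ε).toSubmodule.subtype ∘ₗ nilProj γ ε j)
    (DirectSum.of g i x)

theorem crossCochain_apply (ε : ℤˣ) (i j : ι) (x : g i) (z : g j)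
    (y : (directSum γ).nilPart ε) :
    crossCochain γ ε i j x z y =
      killingForm K (g j) z ((y : ⨁ i, g i) j) • DirectSum.of g i x := rfl

end DirectSum

end LieGrading

end LieHOne

end

open LieHOne

/-! Write `n_j` for `nilPart ε` of `g j`, and view a cochain `F` on the direct sum as a matrix of
components `F_ij : n_j → g i`. Diagonal components of cocycles are cocycles, and the coboundaries
are exactly the diagonal matrices of coboundaries, since an element of the direct sum acts summand
by summand. Hence `H¹` splits into the `H¹` of the summands and the space of off-diagonal parts of
cocycles, with no quotient taken on the latter.

For `i ≠ j` the cocycle equation on `n_i × n_j` says that `F_ij` takes values in the centralizer of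
`n_i` in `g i`, and on `n_j × n_j` that `F_ij` vanishes on `⁅n_j, n_j⁆`. In a `|2|`-grading this
centralizer lies in degree `2ε` (`mem_piece_two_of_lie_eq_zero`), and degree `2ε` is spanned by
brackets of elements of degree `ε` (`piece_two_mul_le_span`). So `F_ij` is a linear map from degree
`ε` to degree `2ε`; every such map occurs, and the Killing form turns it into a tensor. It has
homogeneity `ε`, so every other homogeneity sees the diagonal only.

The centralizer is found by generating an ideal that avoids degree `2ε`; this is impossible for a
nonzero ideal, by the depth hypothesis and nondegeneracy of the Killing form. The spanning statement
is the generation hypothesis when `ε = -1`; for `ε = 1` it is carried over by Killing duality and a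
nilpotent trace argument (`eq_zero_of_lie_piece_one_eq_zero`). -/

namespace LieHOne

/-- If `L = n + q` for subspaces `n` and `q`, if `W` is a `q`-stable subspace and if `x ∈ W`
is annihilated by `n`, then the ideal generated by `x` is contained in `W`. -/
theorem exists_lieIdeal_le {K L : Type*} [CommRing K] [LieRing L] [LieAlgebra K L]
    {n q W : Submodule K L} (hnq : n ⊔ q = ⊤) (hW : ∀ z ∈ q, ∀ w ∈ W, ⁅z, w⁆ ∈ W)
    {x : L} (hxW : x ∈ W) (hx : ∀ y ∈ n, ⁅y, x⁆ = 0) :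
    ∃ I : LieIdeal K L, x ∈ I ∧ I.toSubmodule ≤ W := by
  -- `N` plays the role of `U(q)x`; the point is that it is already stable under `n`, as in the
  -- factorization `U(L) = U(q)U(n)`.
  let N : Submodule K L := sInf {S | x ∈ S ∧ ∀ z ∈ q, ∀ w ∈ S, ⁅z, w⁆ ∈ S}
  have hxN : x ∈ N := by
    rw [Submodule.mem_sInf]; exact fun S hS => hS.1
  have hqN : ∀ z ∈ q, ∀ w ∈ N, ⁅z, w⁆ ∈ N := fun z hz w hw => by
    rw [Submodule.mem_sInf] at hw ⊢
    exact fun S hS => hS.2 z hz w (hw S hS)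
  -- By minimality of `N` it suffices that `S` contains `x` and is `q`-stable. For the latter, `⁅y,
  -- z⁆` is split again along `n + q`.
  let S : Submodule K L :=
    { carrier := {w | w ∈ N ∧ ∀ y ∈ n, ⁅y, w⁆ ∈ N}
      add_mem' := fun ha hb => ⟨add_mem ha.1 hb.1, fun y hy => by
        rw [lie_add]; exact add_mem (ha.2 y hy) (hb.2 y hy)⟩
      zero_mem' := ⟨zero_mem _, fun y _ => by rw [lie_zero]; exact zero_mem _⟩
      smul_mem' := fun c a ha => ⟨N.smul_mem c ha.1, fun y hy => by
        rw [lie_smul]; exact N.smul_mem c (ha.2 y hy)⟩ }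
  have hNS : N ≤ S := by
    refine sInf_le ⟨⟨hxN, fun y hy => ?_⟩, fun z hz w hw => ⟨hqN z hz w hw.1, fun y hy => ?_⟩⟩
    · rw [hx y hy]; exact zero_mem _
    · rw [leibniz_lie]
      refine add_mem ?_ (hqN z hz _ (hw.2 y hy))
      obtain ⟨a, ha, b, hb, hab⟩ := Submodule.mem_sup.1 (hnq ▸ Submodule.mem_top : ⁅y, z⁆ ∈ n ⊔ q)
      rw [← hab, add_lie]
      exact add_mem (hw.2 a ha) (hqN b hb w hw.1)
  refine ⟨{ N with lie_mem := fun {y w} hw => ?_ }, hxN, sInf_le ⟨hxW, hW⟩⟩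
  obtain ⟨a, ha, b, hb, rfl⟩ := Submodule.mem_sup.1 (hnq ▸ Submodule.mem_top : y ∈ n ⊔ q)
  rw [add_lie]
  exact add_mem ((hNS hw).2 a ha) (hqN b hb w hw)

theorem eq_zero_of_killingForm {K L : Type*} [Field K] [CharZero K] [LieRing L] [LieAlgebra K L]
    [FiniteDimensional K L] [LieAlgebra.IsSemisimple K L] {x : L}
    (h : ∀ y, killingForm K L x y = 0) : x = 0 :=
  (LieAlgebra.IsKilling.killingForm_nondegenerate K L).1 x h

/-! ### Graded pieces and the Killing form -/

namespace LieGrading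

variable {K L : Type*} [Field K] [LieRing L] [LieAlgebra K L] (γ : LieGrading K L)

theorem eq_top_of_piece_le {S : Submodule K L} (h : ∀ m, γ.piece m ≤ S) : S = ⊤ := by
  rw [eq_top_iff, ← γ.isInternal.submodule_iSup_eq_top]
  exact iSup_le h

theorem eq_zero_of_mem_of_mem {m n : ℤ} (hmn : m ≠ n) {x : L} (hm : x ∈ γ.piece m)
    (hn : x ∈ γ.piece n) : x = 0 :=
  Submodule.disjoint_def.1 (γ.isInternal.submodule_iSupIndep.pairwiseDisjoint hmn) x hm hn

theorem piece_le_nilPart {ε : ℤˣ} {m : ℤ} (hm : 1 ≤ m) :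
    γ.piece (ε * m) ≤ (γ.nilPart ε).toSubmodule := fun _ hx =>
  γ.mem_nilPart.2 (Submodule.mem_iSup_of_mem (⟨m, hm⟩ : {m : ℤ // 1 ≤ m}) hx)

theorem mem_nilPart_of_mem_one {ε : ℤˣ} {x : L} (hx : x ∈ γ.piece ε) : x ∈ γ.nilPart ε :=
  γ.piece_le_nilPart (m := 1) le_rfl (by rwa [mul_one])

theorem mem_nilPart_of_mem_two {ε : ℤˣ} {x : L} (hx : x ∈ γ.piece (2 * ε)) : x ∈ γ.nilPart ε :=
  γ.piece_le_nilPart (m := 2) (by norm_num) (by rwa [mul_comm])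

/-- Every element is the sum of one of degree `m` and one without component in degree `m`. -/
theorem exists_add_eq (m : ℤ) (x : L) :
    ∃ a ∈ γ.piece m, ∃ b ∈ ⨆ k : {k : ℤ // k ≠ m}, γ.piece k, a + b = x := by
  rw [← Submodule.mem_sup, γ.eq_top_of_piece_le (S := _ ⊔ _) fun k => ?_]
  · exact Submodule.mem_top
  by_cases hk : k = m
  · exact hk ▸ le_sup_left
  · exact le_sup_of_le_right (le_iSup (fun k : {k : ℤ // k ≠ m} => γ.piece k) ⟨k, hk⟩)

section Killing

/-- The pairing of the pieces of opposite degree by the Killing form. -/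
noncomputable def pairing (m n : ℤ) : γ.piece m →ₗ[K] γ.piece n →ₗ[K] K :=
  (killingForm K L).domRestrict₁₂ (γ.piece m) (γ.piece n)

variable [FiniteDimensional K L]

/-- In block form along the grading, such an endomorphism has zero diagonal blocks. -/
theorem trace_eq_zero_of_shift {d : ℤ} (hd : d ≠ 0) (f : Module.End K L)
    (hf : ∀ m, ∀ x ∈ γ.piece m, f x ∈ γ.piece (m + d)) : LinearMap.trace K L f = 0 :=
  LinearMap.trace_eq_zero_of_mapsTo_ne γ.isInternal (fun m => m + d) (fun m => by simpa using hd)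
    hf

theorem killingForm_eq_zero {m n : ℤ} (hmn : m + n ≠ 0) {x y : L} (hx : x ∈ γ.piece m)
    (hy : y ∈ γ.piece n) : killingForm K L x y = 0 := by
  rw [killingForm_apply_apply]
  refine γ.trace_eq_zero_of_shift hmn _ fun k z hz => ?_
  have := γ.lie_mem hx (γ.lie_mem hy hz)
  rwa [show m + (n + k) = k + (m + n) by ring] at this

theorem killingForm_eq_zero_of_mem_iSup {m : ℤ} {x y : L} (hx : x ∈ γ.piece (-m))
    (hy : y ∈ ⨆ k : {k : ℤ // k ≠ m}, γ.piece k) : killingForm K L x y = 0 := by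
  have : (⨆ k : {k : ℤ // k ≠ m}, γ.piece k) ≤ LinearMap.ker (killingForm K L x) :=
    iSup_le fun k y hy => γ.killingForm_eq_zero (by have := k.2; omega) hx hy
  exact this hy

variable [CharZero K] [LieAlgebra.IsSemisimple K L]

theorem eq_zero_of_killingForm_piece {m n : ℤ} (hmn : m + n = 0) {x : L} (hx : x ∈ γ.piece m)
    (h : ∀ y ∈ γ.piece n, killingForm K L x y = 0) : x = 0 := by
  refine eq_zero_of_killingForm (K := K) fun y => ?_
  obtain ⟨a, ha, b, hb, rfl⟩ := γ.exists_add_eq n y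
  obtain rfl : m = -n := by omega
  rw [map_add, h a ha, γ.killingForm_eq_zero_of_mem_iSup hx hb, add_zero]

/-- On the piece of degree `m`, every linear form is represented by an element of degree `-m`. -/
theorem exists_killingForm_eq (m : ℤ) (f : L →ₗ[K] K) :
    ∃ u ∈ γ.piece (-m), ∀ y ∈ γ.piece m, killingForm K L u y = f y := by
  obtain ⟨u, rfl⟩ := (LinearMap.BilinForm.toDual (killingForm K L)
    (LieAlgebra.IsKilling.killingForm_nondegenerate K L)).surjective f
  obtain ⟨a, ha, b, hb, rfl⟩ := γ.exists_add_eq (-m) u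
  refine ⟨a, ha, fun y hy => ?_⟩
  rw [LinearMap.BilinForm.toDual_def, map_add, LinearMap.add_apply, left_eq_add,
    LieModule.traceForm_comm]
  exact γ.killingForm_eq_zero_of_mem_iSup (by rwa [neg_neg]) hb

theorem isPerfPair_pairing {m n : ℤ} (hmn : m + n = 0) : (γ.pairing m n).IsPerfPair := by
  refine .of_injective ?_ ?_ <;>
    refine (injective_iff_map_eq_zero _).2 fun x hx => Subtype.ext ?_
  · exact γ.eq_zero_of_killingForm_piece hmn x.2 fun y hy => LinearMap.congr_fun hx ⟨y, hy⟩
  · refine γ.eq_zero_of_killingForm_piece (m := n) (n := m) (by omega) x.2 fun y hy => ?_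
    rw [LieModule.traceForm_comm]
    exact LinearMap.congr_fun hx ⟨y, hy⟩

/-- The isomorphism `V ⊗ L_m ≃ Hom(L_n, V)`, for `m + n = 0`, given by the Killing form. -/
noncomputable def tensorEquivHom {m n : ℤ} (hmn : m + n = 0) (V : Type*) [AddCommGroup V]
    [Module K V] : (V ⊗[K] γ.piece m) ≃ₗ[K] (γ.piece n →ₗ[K] V) :=
  letI := γ.isPerfPair_pairing hmn
  TensorProduct.comm K _ _ ≪≫ₗ
    LinearEquiv.rTensor V (γ.pairing m n).toPerfPair ≪≫ₗ
    dualTensorHomEquiv K (γ.piece n) V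

theorem tensorEquivHom_tmul {m n : ℤ} (hmn : m + n = 0) {V : Type*} [AddCommGroup V] [Module K V]
    (x : V) (z : γ.piece m) (y : γ.piece n) :
    γ.tensorEquivHom hmn V (x ⊗ₜ z) y = killingForm K L z y • x := by
  rw [tensorEquivHom]
  simp only [LinearEquiv.trans_apply, TensorProduct.comm_tmul, LinearEquiv.rTensor_tmul]
  rfl

end Killing

/-! ### Structure of `|2|`-gradings: generation and centralizers -/

namespace IsKGraded

variable {γ} {k : ℕ}

theorem eq_zero_of_lt_abs (h : γ.IsKGraded k) {m : ℤ} (hm : k < |m|) {x : L}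
    (hx : x ∈ γ.piece m) : x = 0 := by
  rwa [h.piece_eq_bot m hm] at hx

theorem lie_eq_zero (h : γ.IsKGraded k) {m n : ℤ} (hmn : k < |m + n|) {x y : L}
    (hx : x ∈ γ.piece m) (hy : y ∈ γ.piece n) : ⁅x, y⁆ = 0 :=
  h.eq_zero_of_lt_abs hmn (γ.lie_mem hx hy)

variable (h : γ.IsKGraded 2)
include h

theorem exists_add_eq_of_mem_nilPart {ε : ℤˣ} {x : L} (hx : x ∈ γ.nilPart ε) :
    ∃ a ∈ γ.piece ε, ∃ b ∈ γ.piece (2 * ε), a + b = x := by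
  rw [← Submodule.mem_sup]
  have : (⨆ m : {m : ℤ // 1 ≤ m}, γ.piece (ε * m)) ≤ γ.piece ε ⊔ γ.piece (2 * ε) := by
    refine iSup_le fun ⟨m, hm⟩ => ?_
    obtain rfl | rfl | hm : m = 1 ∨ m = 2 ∨ 2 < m := by omega
    · rw [mul_one]; exact le_sup_left
    · rw [mul_comm]; exact le_sup_right
    · rw [h.piece_eq_bot]
      · exact bot_le
      · obtain rfl | rfl := Int.units_eq_one_or ε <;> simp [abs_of_pos (show 0 < m by omega), hm]
  exact this hx

/-- The pieces of degrees `-2, …, 2` span. -/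
theorem linearMap_eq_zero {V : Type*} [AddCommGroup V] [Module K V] (f : L →ₗ[K] V)
    (hf : ∀ m, |m| ≤ 2 → ∀ x ∈ γ.piece m, f x = 0) : f = 0 := by
  refine LinearMap.ker_eq_top.1 (γ.eq_top_of_piece_le fun m x hx => ?_)
  by_cases hm : |m| ≤ 2
  · exact hf m hm x hx
  · rw [h.eq_zero_of_lt_abs (by push_cast; omega) hx]; exact zero_mem _

theorem piece_neg_two_le_span :
    γ.piece (-2) ≤ Submodule.span K {x | ∃ a ∈ γ.piece (-1), ∃ b ∈ γ.piece (-1), ⁅a, b⁆ = x} := by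
  set D := Submodule.span K {x | ∃ a ∈ γ.piece (-1), ∃ b ∈ γ.piece (-1), ⁅a, b⁆ = x}
  have hD2 : D ≤ γ.piece (-2) := Submodule.span_le.2 <| by
    rintro _ ⟨a, ha, b, hb, rfl⟩
    exact γ.lie_mem ha hb
  -- Closed under the bracket because every product other than `⁅L_{-1}, L_{-1}⁆` has degree at most
  -- `-3`.
  let S : LieSubalgebra K L :=
    { γ.piece (-1) ⊔ D with
      lie_mem' := by
        intro x y hx hy
        obtain ⟨a, ha, b, hb, rfl⟩ := Submodule.mem_sup.1 hx
        obtain ⟨c, hc, d, hd, rfl⟩ := Submodule.mem_sup.1 hy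
        rw [add_lie, lie_add, lie_add, h.lie_eq_zero (by norm_num) ha (hD2 hd),
          h.lie_eq_zero (by norm_num) (hD2 hb) hc, h.lie_eq_zero (by norm_num) (hD2 hb) (hD2 hd)]
        simp only [add_zero]
        exact Submodule.mem_sup_right (Submodule.subset_span ⟨a, ha, c, hc, rfl⟩) }
  have hS : γ.nilPart (-1) ≤ S := by
    rw [← h.lieSpan_eq, LieSubalgebra.lieSpan_le]
    exact fun x hx => Submodule.mem_sup_left hx
  intro x hx
  obtain ⟨a, ha, d, hd, rfl⟩ := Submodule.mem_sup.1
    (hS (γ.mem_nilPart_of_mem_two (by simpa using hx)))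
  have ha' : a ∈ γ.piece (-2) := by simpa using sub_mem hx (hD2 hd)
  rw [γ.eq_zero_of_mem_of_mem (by norm_num) ha ha', zero_add]
  exact hd

/-- By the Jacobi identity the elements commuting with `u` are closed under brackets, and degree
`-2` consists of sums of brackets from degree `-1`. -/
theorem lie_eq_zero_of_neg_one {u : L} (hu : ∀ a ∈ γ.piece (-1), ⁅u, a⁆ = 0) :
    ∀ b ∈ γ.piece (-2), ⁅u, b⁆ = 0 := by
  have : Submodule.span K {x | ∃ a ∈ γ.piece (-1), ∃ b ∈ γ.piece (-1), ⁅a, b⁆ = x} ≤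
      LinearMap.ker (LieAlgebra.ad K L u : L →ₗ[K] L) := by
    refine Submodule.span_le.2 ?_
    rintro _ ⟨a, ha, b, hb, rfl⟩
    change ⁅u, ⁅a, b⁆⁆ = 0
    rw [leibniz_lie, hu a ha, hu b hb, zero_lie, lie_zero, add_zero]
  exact fun b hb => this (h.piece_neg_two_le_span hb)

variable [FiniteDimensional K L] [CharZero K] [LieAlgebra.IsSemisimple K L]

/-- It is enough that `u` is Killing-orthogonal to each `y` of degree `2`. The element `⁅y, u⁆` of
degree `0` turns out to centralize degrees `-1`, `-2` and `2`, which forces `(ad u ∘ ad y)² = 0`; a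
nilpotent endomorphism has trace zero. -/
theorem eq_zero_of_lie_piece_one_eq_zero {u : L} (hu : u ∈ γ.piece (-2))
    (hu1 : ∀ a ∈ γ.piece 1, ⁅u, a⁆ = 0) : u = 0 := by
  refine γ.eq_zero_of_killingForm_piece (n := 2) (by norm_num) hu fun y hy => ?_
  have h1 : ∀ v ∈ γ.piece (-1), ⁅⁅y, u⁆, v⁆ = 0 := fun v hv => by
    rw [lie_lie, h.lie_eq_zero (by norm_num) hu hv, hu1 _ (γ.lie_mem hy hv), lie_zero, sub_zero]
  have h2 := h.lie_eq_zero_of_neg_one h1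
  -- Degree `2` is dual to degree `-2`, so invariance of the Killing form transfers `h2` to it.
  have h3 : ∀ z ∈ γ.piece 2, ⁅⁅y, u⁆, z⁆ = 0 := fun z hz => by
    refine γ.eq_zero_of_killingForm_piece (n := -2) (by norm_num)
      (γ.lie_mem (γ.lie_mem hy hu) hz) fun x hx => ?_
    rw [← lie_skew, map_neg, LinearMap.neg_apply, LieModule.traceForm_apply_lie_apply, h2 x hx,
      map_zero, neg_zero]
  have h4 : ∀ z ∈ γ.piece 2, ⁅y, ⁅u, z⁆⁆ = 0 := fun z hz => by
    rw [leibniz_lie, h3 z hz, h.lie_eq_zero (by norm_num) hy hz, lie_zero, add_zero]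
  have h5 : ∀ x ∈ γ.piece (-2), ⁅u, ⁅y, x⁆⁆ = 0 := fun x hx => by
    rw [leibniz_lie, h.lie_eq_zero (by norm_num) hu hx, lie_zero, add_zero, ← lie_skew u y,
      neg_lie, h2 x hx, neg_zero]
  -- Checked degree by degree: `ad u ∘ ad y` already vanishes in degrees `-2` (`h5`), `-1` (`hu1`)
  -- and at least `1`; only degree `0` needs the square, through `h4`.
  have hT : (LieAlgebra.ad K L u ∘ₗ LieAlgebra.ad K L y) ∘ₗ
      (LieAlgebra.ad K L u ∘ₗ LieAlgebra.ad K L y) = 0 := by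
    refine h.linearMap_eq_zero _ fun m hm x hx => ?_
    simp only [LinearMap.comp_apply, LieAlgebra.ad_apply]
    rw [abs_le] at hm
    obtain rfl | rfl | rfl | hm : m = -2 ∨ m = -1 ∨ m = 0 ∨ 1 ≤ m := by omega
    · rw [h5 x hx]; simp
    · rw [hu1 _ (γ.lie_mem hy hx)]; simp
    · rw [h4 _ (γ.lie_mem hy hx)]; simp
    · rw [h.lie_eq_zero (lt_abs.2 (Or.inl (by push_cast; omega))) hy hx]; simp
  rw [killingForm_apply_apply]
  exact (LinearMap.isNilpotent_trace_of_isNilpotent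
    (f := LieAlgebra.ad K L u ∘ₗ LieAlgebra.ad K L y) ⟨2, by rw [pow_two]; exact hT⟩).eq_zero

/-- A linear form vanishing on `⁅L_1, L_1⁆` is represented on `L_2` by some `u` of degree `-2`. By
invariance `⁅u, L_1⁆` is orthogonal to `L_1`, hence zero, and so `u = 0`. -/
theorem piece_two_le_span :
    γ.piece 2 ≤ Submodule.span K {x | ∃ a ∈ γ.piece 1, ∃ b ∈ γ.piece 1, ⁅a, b⁆ = x} := by
  intro y hy
  by_contra hyD
  obtain ⟨f, hfy, hf⟩ := Submodule.exists_le_ker_of_notMem hyD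
  obtain ⟨u, hu, huf⟩ := γ.exists_killingForm_eq 2 f
  refine hfy ?_
  rw [← huf y hy, h.eq_zero_of_lie_piece_one_eq_zero hu fun a ha => ?_, map_zero,
    LinearMap.zero_apply]
  refine γ.eq_zero_of_killingForm_piece (n := 1) (by norm_num) (γ.lie_mem hu ha) fun b hb => ?_
  rw [LieModule.traceForm_apply_lie_apply]
  exact (huf _ (γ.lie_mem ha hb)).trans (hf (Submodule.subset_span ⟨a, ha, b, hb, rfl⟩))

theorem piece_two_mul_le_span (ε : ℤˣ) : γ.piece (2 * ε) ≤
    Submodule.span K {x | ∃ a ∈ γ.piece ε, ∃ b ∈ γ.piece ε, ⁅a, b⁆ = x} := by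
  obtain rfl | rfl := Int.units_eq_one_or ε
  · exact h.piece_two_le_span
  · exact h.piece_neg_two_le_span

/-- The centralizer of the nilpotent subalgebra is the piece of highest (lowest) degree. -/
theorem mem_piece_two_of_lie_eq_zero {ε : ℤˣ} {x : L} (hx : ∀ y ∈ γ.nilPart ε, ⁅y, x⁆ = 0) :
    x ∈ γ.piece (2 * ε) := by
  obtain ⟨a, ha, b, hb, rfl⟩ := γ.exists_add_eq (2 * ε) x
  suffices b = 0 by rwa [this, add_zero]
  -- Since pieces beyond degree `2` vanish, `W` is everything outside degree `2ε`. The degrees in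
  -- `q` can only move away from `2ε`, so `W` is `q`-stable.
  set W : Submodule K L := ⨆ k : {k : ℤ // k < 2}, γ.piece (ε * k)
  set q : Submodule K L := ⨆ k : {k : ℤ // k ≤ 0}, γ.piece (ε * k)
  have hεε : (ε : ℤ) * ε = 1 := by obtain rfl | rfl := Int.units_eq_one_or ε <;> rfl
  have hbW : b ∈ W := by
    refine (iSup_le fun ⟨k, hk⟩ => ?_ : _ ≤ W) hb
    obtain ⟨j, rfl⟩ : ∃ j, k = ε * j := ⟨ε * k, by rw [← mul_assoc, hεε, one_mul]⟩
    rcases lt_trichotomy j 2 with hj | rfl | hj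
    · exact le_iSup (fun k : {k : ℤ // k < 2} => γ.piece (ε * k)) ⟨j, hj⟩
    · exact absurd (mul_comm _ _) hk
    · rw [h.piece_eq_bot]
      · exact bot_le
      · obtain rfl | rfl := Int.units_eq_one_or ε <;> simp [abs_of_pos (show 0 < j by omega), hj]
  have hnq : (γ.nilPart ε).toSubmodule ⊔ q = ⊤ := by
    refine γ.eq_top_of_piece_le fun k => ?_
    obtain ⟨j, rfl⟩ : ∃ j, k = ε * j := ⟨ε * k, by rw [← mul_assoc, hεε, one_mul]⟩
    by_cases hj : 1 ≤ j
    · exact le_sup_of_le_left (γ.piece_le_nilPart hj)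
    · exact le_sup_of_le_right
        (le_iSup (fun k : {k : ℤ // k ≤ 0} => γ.piece (ε * k)) ⟨j, by omega⟩)
  have hqW : ∀ z ∈ q, ∀ w ∈ W, ⁅z, w⁆ ∈ W := fun z hz w hw => by
    induction hz using Submodule.iSup_induction' with
    | zero => rw [zero_lie]; exact zero_mem _
    | add a b _ _ ha hb => rw [add_lie]; exact add_mem ha hb
    | mem m a ha =>
      induction hw using Submodule.iSup_induction' with
      | zero => rw [lie_zero]; exact zero_mem _
      | add b c _ _ hb hc => rw [lie_add]; exact add_mem hb hc
      | mem n b hb =>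
        refine Submodule.mem_iSup_of_mem (⟨m + n, by have := m.2; have := n.2; omega⟩ :
          {m : ℤ // m < 2}) ?_
        have := γ.lie_mem ha hb
        rwa [← mul_add] at this
  -- The part `a` is killed for degree reasons (degrees `3ε` and `4ε`), so `b` inherits the
  -- annihilation from `x`.
  have hb0 : ∀ y ∈ (γ.nilPart ε).toSubmodule, ⁅y, b⁆ = 0 := fun y hy => by
    have h1 := hx y hy
    rw [lie_add] at h1
    suffices ⁅y, a⁆ = 0 by rwa [this, zero_add] at h1
    obtain ⟨c, hc, d, hd, rfl⟩ := h.exists_add_eq_of_mem_nilPart hy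
    rw [add_lie, h.lie_eq_zero _ hc ha, h.lie_eq_zero _ hd ha, add_zero] <;>
    obtain rfl | rfl := Int.units_eq_one_or ε <;> norm_num
  obtain ⟨N, hbN, hNW⟩ := exists_lieIdeal_le hnq hqW hbW hb0
  have hperp : ∀ u ∈ γ.piece (-(2 * ε)), ∀ w ∈ W, killingForm K L u w = 0 := fun u hu w hw => by
    refine γ.killingForm_eq_zero_of_mem_iSup hu
      ((iSup_le fun ⟨k, hk⟩ => ?_ : W ≤ _) hw)
    refine le_iSup (fun k : {k : ℤ // k ≠ 2 * (ε : ℤ)} => γ.piece k) ⟨ε * k, fun hk' => hk.ne ?_⟩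
    rw [mul_comm] at hk'
    exact mul_right_cancel₀ (Units.ne_zero ε) hk'
  obtain hN | ⟨I, hI, hIN⟩ := eq_bot_or_exists_atom_le N
  · rwa [hN, LieSubmodule.mem_bot] at hbN
  · obtain ⟨u, huI, hu, hu0⟩ := h.exists_mem I hI
    refine absurd ?_ hu0
    push_cast at hu
    -- The depth hypothesis only speaks of degree `-2`, so the signs differ. For `ε = 1`, `u` is
    -- orthogonal to `W`, hence lies in `N` and in its Killing complement. For `ε = -1`, `u` itself
    -- lies in `W`, which is orthogonal to degree `2`.
    obtain rfl | rfl := Int.units_eq_one_or ε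
    · have := (LieIdeal.isCompl_killingCompl N).disjoint
      refine (LieSubmodule.mem_bot (R := K) (L := L) u).1
        (this.le_bot ⟨hIN huI, (LieIdeal.mem_killingCompl K L N).2 fun w hw => ?_⟩)
      rw [LieModule.traceForm_comm]
      exact hperp u hu w (hNW hw)
    · refine γ.eq_zero_of_killingForm_piece (n := 2) (by norm_num) hu fun y hy => ?_
      rw [LieModule.traceForm_comm]
      exact hperp y hy u (hNW (hIN huI))

end IsKGraded

end LieGrading

open LieModule.Cohomology

/-! ### Matrix components of cochains on the direct sum -/

namespace LieGrading

variable {K : Type*} [Field K] {ι : Type*} [DecidableEq ι] {g : ι → Type*}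
  [∀ i, LieRing (g i)] [∀ i, LieAlgebra K (g i)] (γ : ∀ i, LieGrading K (g i))

theorem of_mem_directSum_piece {i : ι} {m : ℤ} {x : g i} (hx : x ∈ (γ i).piece m) :
    DirectSum.of g i x ∈ (directSum γ).piece m := fun j => by
  by_cases hij : j = i
  · subst hij; rwa [DirectSum.of_eq_same]
  · rw [DirectSum.of_eq_of_ne _ _ _ hij]; exact zero_mem _

theorem of_mem_directSum_nilPart {ε : ℤˣ} {i : ι} {x : g i} (hx : x ∈ (γ i).nilPart ε) :
    DirectSum.of g i x ∈ (directSum γ).nilPart ε := by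
  rw [mem_nilPart] at hx ⊢
  have h := Submodule.mem_map_of_mem (f := DirectSum.lof K ι g i) hx
  simp only [Submodule.map_iSup] at h
  refine SetLike.le_def.mp (iSup_mono fun n => ?_) h
  rintro _ ⟨y, hy, rfl⟩
  exact of_mem_directSum_piece γ hy

theorem lie_of_of_ne {i j : ι} (hij : i ≠ j) (x : g i) (y : g j) :
    ⁅DirectSum.of g i x, DirectSum.of g j y⁆ = 0 := by
  rw [lie_of_right, DirectSum.of_eq_of_ne _ _ _ hij.symm, zero_lie, map_zero]

/-- The inclusion of the nilpotent subalgebra of `g j` into that of `⨁ i, g i`. -/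
noncomputable def nilIncl (ε : ℤˣ) (j : ι) : (γ j).nilPart ε →ₗ[K] (directSum γ).nilPart ε :=
  (DirectSum.lof K ι g j).restrict fun _ hx => of_mem_directSum_nilPart γ hx

theorem coe_nilIncl {ε : ℤˣ} {j : ι} (x : (γ j).nilPart ε) :
    (nilIncl γ ε j x : ⨁ i, g i) = DirectSum.of g j x := rfl

theorem nilProj_nilIncl_same {ε : ℤˣ} {j : ι} (x : (γ j).nilPart ε) :
    nilProj γ ε j (nilIncl γ ε j x) = x :=
  Subtype.ext (DirectSum.of_eq_same j (x : g j))

theorem nilProj_nilIncl_of_ne {ε : ℤˣ} {i j : ι} (hij : i ≠ j) (x : (γ j).nilPart ε) :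
    nilProj γ ε i (nilIncl γ ε j x) = 0 :=
  Subtype.ext (DirectSum.of_eq_of_ne _ _ _ hij)

theorem sum_nilIncl_nilProj [Fintype ι] {ε : ℤˣ} (y : (directSum γ).nilPart ε) :
    ∑ j, nilIncl γ ε j (nilProj γ ε j y) = y := by
  refine Subtype.ext ?_
  rw [AddSubmonoidClass.coe_finsetSum]
  exact DirectSum.sum_univ_of (y : ⨁ i, g i)

/-- The component of a cochain that maps the `j`-th summand to the `i`-th one. -/
noncomputable def componentCochain (ε : ℤˣ) (i j : ι) :
    oneCochain K ((directSum γ).nilPart ε) (⨁ i, g i) →ₗ[K]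
      oneCochain K ((γ j).nilPart ε) (g i) :=
  LinearMap.llcomp K _ _ _ (DirectSum.component K ι g i) ∘ₗ
    LinearMap.lcomp K (⨁ i, g i) (nilIncl γ ε j)

theorem componentCochain_apply {ε : ℤˣ} {i j : ι}
    (F : oneCochain K ((directSum γ).nilPart ε) (⨁ i, g i)) (y : (γ j).nilPart ε) :
    componentCochain γ ε i j F y = F (nilIncl γ ε j y) i := rfl

theorem componentCochain_ext [Fintype ι] {ε : ℤˣ}
    {F G : oneCochain K ((directSum γ).nilPart ε) (⨁ i, g i)}
    (h : ∀ i j, componentCochain γ ε i j F = componentCochain γ ε i j G) : F = G := by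
  refine LinearMap.ext fun y => ?_
  rw [← sum_nilIncl_nilProj γ y, map_sum, map_sum]
  refine Finset.sum_congr rfl fun j _ => DFinsupp.ext fun i => ?_
  exact LinearMap.congr_fun (h i j) (nilProj γ ε j y)

theorem componentCochain_extendCochain_same {ε : ℤˣ} {i : ι}
    (f : oneCochain K ((γ i).nilPart ε) (g i)) :
    componentCochain γ ε i i (extendCochain γ ε i f) = f := by
  refine LinearMap.ext fun y => ?_
  rw [componentCochain_apply, extendCochain_apply, nilProj_nilIncl_same, DirectSum.of_eq_same]

theorem componentCochain_extendCochain_of_ne {ε : ℤˣ} {i j k : ι} (hk : i ≠ k ∨ j ≠ k)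
    (f : oneCochain K ((γ k).nilPart ε) (g k)) :
    componentCochain γ ε i j (extendCochain γ ε k f) = 0 := by
  refine LinearMap.ext fun y => ?_
  rw [componentCochain_apply, extendCochain_apply]
  obtain hk | hk := hk
  · rw [DirectSum.of_eq_of_ne _ _ _ hk]; rfl
  · rw [nilProj_nilIncl_of_ne γ hk.symm, map_zero, map_zero]; rfl

theorem componentCochain_crossCochain_same {ε : ℤˣ} {i j : ι} (x : g i) (z : g j)
    (y : (γ j).nilPart ε) :
    componentCochain γ ε i j (crossCochain γ ε i j x z) y = killingForm K (g j) z y • x := by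
  rw [componentCochain_apply, crossCochain_apply, coe_nilIncl, DirectSum.of_eq_same,
    DirectSum.smul_apply, DirectSum.of_eq_same]

theorem componentCochain_crossCochain_of_ne {ε : ℤˣ} {i j k l : ι} (hk : i ≠ k ∨ j ≠ l)
    (x : g k) (z : g l) :
    componentCochain γ ε i j (crossCochain γ ε k l x z) = 0 := by
  refine LinearMap.ext fun y => ?_
  rw [componentCochain_apply, crossCochain_apply, coe_nilIncl]
  obtain hk | hk := hk
  · rw [DirectSum.smul_apply, DirectSum.of_eq_of_ne _ _ _ hk, smul_zero]; rfl
  · rw [DirectSum.of_eq_of_ne _ _ _ hk.symm, map_zero, zero_smul]; rfl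

/-! ### The cocycle equation in components -/

section Cocycle

variable {γ} {ε : ℤˣ} {F : oneCochain K ((directSum γ).nilPart ε) (⨁ i, g i)}

theorem componentCochain_mem_ZOne (hF : F ∈ ZOne K ((directSum γ).nilPart ε) (⨁ i, g i)) (i : ι) :
    componentCochain γ ε i i F ∈ ZOne K ((γ i).nilPart ε) (g i) := by
  rw [mem_ZOne] at hF ⊢
  intro x y
  have h := congrArg (fun v : ⨁ i, g i => v i) (hF (nilIncl γ ε i x) (nilIncl γ ε i y))
  have hxy : ⁅nilIncl γ ε i x, nilIncl γ ε i y⁆ = nilIncl γ ε i ⁅x, y⁆ := Subtype.ext <| by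
    rw [LieSubalgebra.coe_bracket, coe_nilIncl, coe_nilIncl, coe_nilIncl, lie_of_right,
      DirectSum.of_eq_same, LieSubalgebra.coe_bracket]
  simp only [hxy, LieSubalgebra.coe_bracket_of_module, DirectSum.sub_apply,
    DirectSum.bracket_apply, coe_nilIncl, DirectSum.of_eq_same] at h
  exact h

theorem componentCochain_mem_BOne (hF : F ∈ BOne K ((directSum γ).nilPart ε) (⨁ i, g i)) (i : ι) :
    componentCochain γ ε i i F ∈ BOne K ((γ i).nilPart ε) (g i) := by
  obtain ⟨m, rfl⟩ := hF
  refine ⟨m i, LinearMap.ext fun y => ?_⟩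
  rw [componentCochain_apply, dZero_apply, dZero_apply, LieSubalgebra.coe_bracket_of_module,
    LieSubalgebra.coe_bracket_of_module, DirectSum.bracket_apply, coe_nilIncl,
    DirectSum.of_eq_same]

theorem componentCochain_eq_zero_of_mem_BOne {i j : ι} (hij : i ≠ j)
    (hF : F ∈ BOne K ((directSum γ).nilPart ε) (⨁ i, g i)) :
    componentCochain γ ε i j F = 0 := by
  obtain ⟨m, rfl⟩ := hF
  refine LinearMap.ext fun y => ?_
  rw [componentCochain_apply, dZero_apply, LieSubalgebra.coe_bracket_of_module,
    DirectSum.bracket_apply, coe_nilIncl, DirectSum.of_eq_of_ne _ _ _ hij, zero_lie]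
  rfl

/-- This is the `i`-th coordinate of the cocycle equation with one argument from each summand: the
two arguments commute, and the one from `g j` acts by zero on `g i`. -/
theorem lie_componentCochain_eq_zero {i j : ι} (hij : i ≠ j)
    (hF : F ∈ ZOne K ((directSum γ).nilPart ε) (⨁ i, g i)) {x : g i} (hx : x ∈ (γ i).nilPart ε)
    (y : (γ j).nilPart ε) : ⁅x, componentCochain γ ε i j F y⁆ = 0 := by
  rw [mem_ZOne] at hF
  have h := congrArg (fun v : ⨁ i, g i => v i) (hF (nilIncl γ ε i ⟨x, hx⟩) (nilIncl γ ε j y))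
  have hxy : ⁅nilIncl γ ε i ⟨x, hx⟩, nilIncl γ ε j y⁆ = 0 := Subtype.ext <| by
    rw [LieSubalgebra.coe_bracket, coe_nilIncl, coe_nilIncl, lie_of_of_ne hij]; rfl
  simp only [hxy, LieSubalgebra.coe_bracket_of_module, DirectSum.sub_apply, map_zero,
    DirectSum.bracket_apply, coe_nilIncl, DirectSum.of_eq_same, DirectSum.of_eq_of_ne _ _ _ hij,
    zero_lie, sub_zero, DirectSum.zero_apply] at h
  exact h

/-- With both arguments in `g j`, the two action terms have no `i`-th coordinate, so only the
bracket term survives. -/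
theorem componentCochain_lie_eq_zero {i j : ι} (hij : i ≠ j)
    (hF : F ∈ ZOne K ((directSum γ).nilPart ε) (⨁ i, g i)) (x y : (γ j).nilPart ε) :
    componentCochain γ ε i j F ⁅x, y⁆ = 0 := by
  rw [mem_ZOne] at hF
  have h := congrArg (fun v : ⨁ i, g i => v i) (hF (nilIncl γ ε j x) (nilIncl γ ε j y))
  have hxy : ⁅nilIncl γ ε j x, nilIncl γ ε j y⁆ = nilIncl γ ε j ⁅x, y⁆ := Subtype.ext <| by
    rw [LieSubalgebra.coe_bracket, coe_nilIncl, coe_nilIncl, coe_nilIncl, lie_of_right,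
      DirectSum.of_eq_same, LieSubalgebra.coe_bracket]
  simp only [hxy, LieSubalgebra.coe_bracket_of_module, DirectSum.sub_apply,
    DirectSum.bracket_apply, coe_nilIncl, DirectSum.of_eq_of_ne _ _ _ hij,
    zero_lie, zero_sub, sub_zero, DirectSum.zero_apply, neg_eq_zero] at h
  exact h

end Cocycle

/-! ### Off-diagonal components as tensors -/

section KGraded

variable {γ} (hγ : ∀ i, (γ i).IsKGraded 2) {ε : ℤˣ}
include hγ

section

variable [∀ i, FiniteDimensional K (g i)]

/-- All three terms of the cocycle equation vanish separately: `x` is centralized by the nilpotent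
part, and `z`, of degree `-ε`, is orthogonal to all brackets, whose degrees are multiples of `ε` by
at least `2`. -/
theorem crossCochain_mem_ZOne {i j : ι} {x : g i} {z : g j} (hx : x ∈ (γ i).piece (2 * ε))
    (hz : z ∈ (γ j).piece (-ε)) :
    crossCochain γ ε i j x z ∈ ZOne K ((directSum γ).nilPart ε) (⨁ i, g i) := by
  have hεne : (ε : ℤ) ≠ 0 := Units.ne_zero ε
  have h1 : ∀ y ∈ (γ i).nilPart ε, ⁅y, x⁆ = 0 := fun y hy => by
    obtain ⟨c, hc, d, hd, rfl⟩ := (hγ i).exists_add_eq_of_mem_nilPart hy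
    rw [add_lie, (hγ i).lie_eq_zero _ hc hx, (hγ i).lie_eq_zero _ hd hx, add_zero] <;>
    obtain rfl | rfl := Int.units_eq_one_or ε <;> norm_num
  have h2 : ∀ y ∈ (γ j).nilPart ε, ∀ y' ∈ (γ j).nilPart ε, killingForm K (g j) z ⁅y, y'⁆ = 0 := by
    intro y hy y' hy'
    obtain ⟨a, ha, b, hb, rfl⟩ := (hγ j).exists_add_eq_of_mem_nilPart hy
    obtain ⟨c, hc, d, hd, rfl⟩ := (hγ j).exists_add_eq_of_mem_nilPart hy'
    simp only [add_lie, lie_add, map_add]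
    rw [(γ j).killingForm_eq_zero _ hz ((γ j).lie_mem ha hc),
      (γ j).killingForm_eq_zero _ hz ((γ j).lie_mem ha hd),
      (γ j).killingForm_eq_zero _ hz ((γ j).lie_mem hb hc),
      (γ j).killingForm_eq_zero _ hz ((γ j).lie_mem hb hd)] <;> first | simp; done | omega
  have h3 : ∀ y ∈ (directSum γ).nilPart ε, ∀ c : K, ⁅y, c • DirectSum.of g i x⁆ = 0 :=
    fun y hy c => by
      have : c • DirectSum.of g i x = DirectSum.of g i (c • x) :=
        ((DirectSum.lof K ι g i).map_smul c x).symm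
      rw [this, lie_of_right, lie_smul, h1 _ (apply_mem_nilPart γ hy i), smul_zero, map_zero]
  rw [mem_ZOne]
  intro y y'
  rw [crossCochain_apply, crossCochain_apply, crossCochain_apply,
    LieSubalgebra.coe_bracket_of_module, LieSubalgebra.coe_bracket_of_module, h3 _ y.2, h3 _ y'.2,
    LieSubalgebra.coe_bracket, DirectSum.bracket_apply,
    h2 _ (apply_mem_nilPart γ y.2 j) _ (apply_mem_nilPart γ y'.2 j), zero_smul, sub_zero, sub_zero]

/-- The tensor `x ⊗ z` as a cocycle. -/
noncomputable def crossMap (ε : ℤˣ) (i j : ι) :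
    ((γ i).piece (2 * ε) ⊗[K] (γ j).piece (-ε)) →ₗ[K]
      ZOne K ((directSum γ).nilPart ε) (⨁ i, g i) :=
  TensorProduct.lift <| LinearMap.mk₂ K
    (fun x z => ⟨crossCochain γ ε i j x z, crossCochain_mem_ZOne hγ x.2 z.2⟩)
    (fun x x' z => Subtype.ext <| LinearMap.ext fun y => by
      simp [crossCochain_apply])
    (fun c x z => Subtype.ext <| LinearMap.ext fun y => by
      change (_ : K) • DirectSum.lof K ι g i (c • (x : g i)) = c • (_ : K) • DirectSum.lof K ι g i x
      rw [map_smul, smul_comm])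
    (fun x z z' => Subtype.ext <| LinearMap.ext fun y => by
      simp [crossCochain_apply, add_smul])
    (fun c x z => Subtype.ext <| LinearMap.ext fun y => by
      simp [crossCochain_apply, mul_smul])

theorem crossMap_tmul {i j : ι} (x : (γ i).piece (2 * ε)) (z : (γ j).piece (-ε)) :
    crossMap hγ ε i j (x ⊗ₜ z) =
      ⟨crossCochain γ ε i j x z, crossCochain_mem_ZOne hγ x.2 z.2⟩ := rfl

theorem crossMap_mem_homogeneousZOne {i j : ι}
    (t : (γ i).piece (2 * ε) ⊗[K] (γ j).piece (-ε)) :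
    crossMap hγ ε i j t ∈ (directSum γ).homogeneousZOne ε ε := by
  induction t using TensorProduct.induction_on with
  | zero => rw [map_zero]; exact zero_mem _
  | add s t hs ht => rw [map_add]; exact add_mem hs ht
  | tmul x z =>
    intro m y hy
    rw [crossMap_tmul, crossCochain_apply]
    by_cases hm : m = ε
    · rw [hm, ← two_mul]
      exact Submodule.smul_mem _ _ (of_mem_directSum_piece γ x.2)
    · rw [(γ j).killingForm_eq_zero (by omega) z.2 (hy j), zero_smul]
      exact zero_mem _

theorem componentCochain_crossMap_of_ne {i j k l : ι} (hk : i ≠ k ∨ j ≠ l)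
    (t : (γ k).piece (2 * ε) ⊗[K] (γ l).piece (-ε)) :
    componentCochain γ ε i j (crossMap hγ ε k l t).1 = 0 := by
  induction t using TensorProduct.induction_on with
  | zero => rw [map_zero]; exact map_zero _
  | add s t hs ht => rw [map_add, Submodule.coe_add, map_add, hs, ht, add_zero]
  | tmul x z => rw [crossMap_tmul, componentCochain_crossCochain_of_ne γ hk]

end

variable [∀ i, FiniteDimensional K (g i)] [CharZero K] [∀ i, LieAlgebra.IsSemisimple K (g i)]

/-- The link to the isomorphism `tensorEquivHom`, from which both injectivity and surjectivity of
the cross terms are read off. -/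
theorem componentCochain_crossMap_same {i j : ι}
    (t : (γ i).piece (2 * ε) ⊗[K] (γ j).piece (-ε)) {y : (γ j).nilPart ε}
    (hy : (y : g j) ∈ (γ j).piece ε) :
    componentCochain γ ε i j (crossMap hγ ε i j t).1 y =
      (γ j).tensorEquivHom (neg_add_cancel (ε : ℤ)) ((γ i).piece (2 * ε)) t ⟨y, hy⟩ := by
  induction t using TensorProduct.induction_on with
  | zero => rw [map_zero, map_zero]; rfl
  | add s t hs ht =>
    rw [map_add, map_add, Submodule.coe_add, map_add, LinearMap.add_apply, hs, ht]; rfl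
  | tmul x z =>
    rw [crossMap_tmul, componentCochain_crossCochain_same, tensorEquivHom_tmul]; rfl

theorem componentCochain_eq_zero_of_mem_piece_two {i j : ι} (hij : i ≠ j)
    {F : oneCochain K ((directSum γ).nilPart ε) (⨁ i, g i)}
    (hF : F ∈ ZOne K ((directSum γ).nilPart ε) (⨁ i, g i)) {y : (γ j).nilPart ε}
    (hy : (y : g j) ∈ (γ j).piece (2 * ε)) : componentCochain γ ε i j F y = 0 := by
  have h : Submodule.span K {x | ∃ a ∈ (γ j).piece ε, ∃ b ∈ (γ j).piece ε, ⁅a, b⁆ = x} ≤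
      (LinearMap.ker (componentCochain γ ε i j F)).map
        ((γ j).nilPart ε).toSubmodule.subtype := by
    refine Submodule.span_le.2 ?_
    rintro _ ⟨a, ha, b, hb, rfl⟩
    exact ⟨⁅⟨a, (γ j).mem_nilPart_of_mem_one ha⟩, ⟨b, (γ j).mem_nilPart_of_mem_one hb⟩⁆,
      componentCochain_lie_eq_zero hij hF _ _, rfl⟩
  obtain ⟨z, hz, hzy⟩ := h ((hγ j).piece_two_mul_le_span ε hy)
  rwa [← show z = y from Subtype.ext hzy]

theorem componentCochain_mem_piece_two {i j : ι} (hij : i ≠ j)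
    {F : oneCochain K ((directSum γ).nilPart ε) (⨁ i, g i)}
    (hF : F ∈ ZOne K ((directSum γ).nilPart ε) (⨁ i, g i)) (y : (γ j).nilPart ε) :
    componentCochain γ ε i j F y ∈ (γ i).piece (2 * ε) :=
  (hγ i).mem_piece_two_of_lie_eq_zero fun _ hx => lie_componentCochain_eq_zero hij hF hx y

/-- An off-diagonal component of a cocycle is determined by its restriction to degree `ε`. -/
theorem componentCochain_eq_of_eqOn {i j : ι} (hij : i ≠ j)
    {F G : oneCochain K ((directSum γ).nilPart ε) (⨁ i, g i)}
    (hF : F ∈ ZOne K ((directSum γ).nilPart ε) (⨁ i, g i))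
    (hG : G ∈ ZOne K ((directSum γ).nilPart ε) (⨁ i, g i))
    (h : ∀ y : (γ j).nilPart ε, (y : g j) ∈ (γ j).piece ε →
      componentCochain γ ε i j F y = componentCochain γ ε i j G y) :
    componentCochain γ ε i j F = componentCochain γ ε i j G := by
  refine LinearMap.ext fun y => ?_
  obtain ⟨a, ha, b, hb, hab⟩ := (hγ j).exists_add_eq_of_mem_nilPart y.2
  obtain rfl : ⟨a, (γ j).mem_nilPart_of_mem_one ha⟩ + ⟨b, (γ j).mem_nilPart_of_mem_two hb⟩ = y :=
    Subtype.ext hab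
  have hb' := (γ j).mem_nilPart_of_mem_two hb
  rw [map_add, map_add, h _ ha,
    componentCochain_eq_zero_of_mem_piece_two hγ hij hF (y := ⟨b, hb'⟩) hb,
    componentCochain_eq_zero_of_mem_piece_two hγ hij hG (y := ⟨b, hb'⟩) hb]

theorem exists_componentCochain_crossMap_eq {i j : ι} (hij : i ≠ j)
    {F : oneCochain K ((directSum γ).nilPart ε) (⨁ i, g i)}
    (hF : F ∈ ZOne K ((directSum γ).nilPart ε) (⨁ i, g i)) :
    ∃ t, componentCochain γ ε i j (crossMap hγ ε i j t).1 = componentCochain γ ε i j F := by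
  let f : (γ j).piece ε →ₗ[K] (γ i).piece (2 * ε) :=
    ((componentCochain γ ε i j F).codRestrict _ (componentCochain_mem_piece_two hγ hij hF)) ∘ₗ
      Submodule.inclusion fun _ hx => (γ j).mem_nilPart_of_mem_one hx
  refine ⟨((γ j).tensorEquivHom (neg_add_cancel (ε : ℤ)) ((γ i).piece (2 * ε))).symm f,
    componentCochain_eq_of_eqOn hγ hij (Subtype.property _) hF fun y hy => ?_⟩
  rw [componentCochain_crossMap_same hγ _ hy, LinearEquiv.apply_symm_apply]
  rfl

theorem eq_zero_of_componentCochain_crossMap {i j : ι}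
    {t : (γ i).piece (2 * ε) ⊗[K] (γ j).piece (-ε)}
    (ht : componentCochain γ ε i j (crossMap hγ ε i j t).1 = 0) : t = 0 := by
  refine ((γ j).tensorEquivHom (neg_add_cancel (ε : ℤ)) ((γ i).piece (2 * ε))).map_eq_zero_iff.1
    (LinearMap.ext fun y => Subtype.ext ?_)
  rw [← componentCochain_crossMap_same hγ t
    (y := ⟨y, (γ j).mem_nilPart_of_mem_one y.2⟩) y.2, ht]
  rfl

theorem componentCochain_eq_zero_of_homogeneous {i j : ι} (hij : i ≠ j) {l : ℤ} (hl : l ≠ ε)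
    {F : ZOne K ((directSum γ).nilPart ε) (⨁ i, g i)}
    (hF : F ∈ (directSum γ).homogeneousZOne ε l) : componentCochain γ ε i j F.1 = 0 := by
  rw [← map_zero (componentCochain γ ε i j)]
  refine componentCochain_eq_of_eqOn hγ hij F.2 (zero_mem _) fun y hy => ?_
  rw [map_zero]
  -- The value has degree `ε + l` by homogeneity and degree `2ε` by the centralizer argument.
  exact (γ i).eq_zero_of_mem_of_mem (m := ε + l) (by omega)
    (hF ε (nilIncl γ ε j y) (of_mem_directSum_piece γ hy) i)
    (componentCochain_mem_piece_two hγ hij F.2 y)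

end KGraded

end LieGrading

/-! ### Direct sum decompositions detected by families of linear maps -/

section LinearAlgebra

variable {K : Type*} [Field K] {ι κ : Type*} [DecidableEq ι]
  {A : ι → Type*} [∀ i, AddCommMonoid (A i)] [∀ i, Module K (A i)]
  {C : κ → Type*} [∀ p, AddCommMonoid (C p)] [∀ p, Module K (C p)]
  {D : κ → Type*} [∀ p, AddCommMonoid (D p)] [∀ p, Module K (D p)]
  {H : Type*} [AddCommMonoid H] [Module K H]
  {E : ∀ i, A i →ₗ[K] H} {T : ∀ p, C p →ₗ[K] H}
  {π : ∀ i, H →ₗ[K] A i} {ρ : ∀ p, H →ₗ[K] D p}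

theorem toModule_retract (hπE : ∀ i a, π i (E i a) = a)
    (hπE' : ∀ i k, i ≠ k → ∀ a, π i (E k a) = 0) (i : ι) (c : ⨁ i, A i) :
    π i (DirectSum.toModule K ι H E c) = c i := by
  induction c using DirectSum.induction_on with
  | zero => rw [map_zero, map_zero]; rfl
  | add x y hx hy => rw [map_add, map_add, hx, hy]; rfl
  | of k a =>
    rw [← DirectSum.lof_eq_of K, DirectSum.toModule_lof, DirectSum.lof_eq_of]
    by_cases hik : i = k
    · subst hik; rw [hπE, DirectSum.of_eq_same]
    · rw [hπE' i k hik, DirectSum.of_eq_of_ne _ _ _ hik]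

theorem toModule_annihilated {V : Type*} [AddCommMonoid V] [Module K V] {f : H →ₗ[K] V}
    (hf : ∀ i a, f (E i a) = 0) (c : ⨁ i, A i) : f (DirectSum.toModule K ι H E c) = 0 := by
  induction c using DirectSum.induction_on with
  | zero => rw [map_zero, map_zero]
  | add x y hx hy => rw [map_add, map_add, hx, hy, add_zero]
  | of k a => rw [← DirectSum.lof_eq_of K, DirectSum.toModule_lof, hf]

theorem toModule_mem [Fintype ι] {S : Submodule K H} {c : ⨁ i, A i} (h : ∀ i, E i (c i) ∈ S) :
    DirectSum.toModule K ι H E c ∈ S := by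
  rw [← DirectSum.sum_univ_of c, map_sum]
  refine sum_mem fun i _ => ?_
  rw [← DirectSum.lof_eq_of K, DirectSum.toModule_lof]
  exact h i

theorem exists_toModule_eq [Fintype ι] (hπE : ∀ i a, π i (E i a) = a)
    (hπE' : ∀ i k, i ≠ k → ∀ a, π i (E k a) = 0) (hρE : ∀ p i a, ρ p (E i a) = 0)
    (hπρ : ∀ h h', (∀ i, π i h = π i h') → (∀ p, ρ p h = ρ p h') → h = h') {h : H}
    (hρ : ∀ p, ρ p h = 0) :
    ∃ c : ⨁ i, A i, (∀ i, c i = π i h) ∧ DirectSum.toModule K ι H E c = h := by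
  refine ⟨DFinsupp.equivFunOnFintype.symm fun i => π i h, fun i => rfl, ?_⟩
  refine hπρ _ _ (fun i => toModule_retract hπE hπE' i _) fun p => ?_
  rw [toModule_annihilated (hρE p), hρ]

variable [DecidableEq κ]

theorem toModule_separated (hρT' : ∀ p q, p ≠ q → ∀ t, ρ p (T q t) = 0) (p : κ) (c : ⨁ p, C p) :
    ρ p (DirectSum.toModule K κ H T c) = ρ p (T p (c p)) := by
  induction c using DirectSum.induction_on with
  | zero => rw [map_zero, map_zero, DirectSum.zero_apply, map_zero, map_zero]
  | add x y hx hy => rw [map_add, map_add, hx, hy, DirectSum.add_apply, map_add, map_add]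
  | of q t =>
    rw [← DirectSum.lof_eq_of K, DirectSum.toModule_lof, DirectSum.lof_eq_of]
    by_cases hpq : p = q
    · subst hpq; rw [DirectSum.of_eq_same]
    · rw [hρT' p q hpq, DirectSum.of_eq_of_ne _ _ _ hpq, map_zero, map_zero]

theorem coprod_toModule_injective (hπE : ∀ i a, π i (E i a) = a)
    (hπE' : ∀ i k, i ≠ k → ∀ a, π i (E k a) = 0) (hπT : ∀ i p t, π i (T p t) = 0)
    (hρE : ∀ p i a, ρ p (E i a) = 0) (hρT' : ∀ p q, p ≠ q → ∀ t, ρ p (T q t) = 0)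
    (hρT : ∀ p t t', ρ p (T p t) = ρ p (T p t') → t = t') :
    Function.Injective
      (LinearMap.coprod (DirectSum.toModule K ι H E) (DirectSum.toModule K κ H T)) := by
  rintro ⟨c, t⟩ ⟨c', t'⟩ h
  rw [LinearMap.coprod_apply, LinearMap.coprod_apply] at h
  refine Prod.ext (DFinsupp.ext fun i => ?_) (DFinsupp.ext fun p => hρT p _ _ ?_)
  · have h1 := congrArg (π i) h
    simp only [map_add, toModule_retract hπE hπE', toModule_annihilated (hπT i), add_zero] at h1
    exact h1
  · have h1 := congrArg (ρ p) h
    simp only [map_add, toModule_annihilated (hρE p), toModule_separated hρT', zero_add] at h1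
    exact h1

/-- The detecting maps `ρ p` may have targets larger than `C p` (here, all cochains), so `hρT` asks
only that `ρ p ∘ T p` reach the image of `ρ p`. -/
theorem coprod_toModule_surjective [Fintype ι] [Fintype κ] (hπE : ∀ i a, π i (E i a) = a)
    (hπE' : ∀ i k, i ≠ k → ∀ a, π i (E k a) = 0) (hπT : ∀ i p t, π i (T p t) = 0)
    (hρE : ∀ p i a, ρ p (E i a) = 0) (hρT' : ∀ p q, p ≠ q → ∀ t, ρ p (T q t) = 0)
    (hρT : ∀ p h, ∃ t, ρ p (T p t) = ρ p h)
    (hπρ : ∀ h h', (∀ i, π i h = π i h') → (∀ p, ρ p h = ρ p h') → h = h') :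
    Function.Surjective
      (LinearMap.coprod (DirectSum.toModule K ι H E) (DirectSum.toModule K κ H T)) := by
  intro h
  choose t ht using fun p => hρT p h
  refine ⟨(DFinsupp.equivFunOnFintype.symm fun i => π i h, DFinsupp.equivFunOnFintype.symm t), ?_⟩
  rw [LinearMap.coprod_apply]
  refine hπρ _ _ (fun i => ?_) fun p => ?_
  · rw [map_add, toModule_retract hπE hπE', toModule_annihilated (hπT i), add_zero]
    rfl
  · rw [map_add, toModule_annihilated (hρE p), toModule_separated hρT', zero_add, ← ht]
    rfl

end LinearAlgebra

/-! ### Diagonal and off-diagonal parts of cohomology classes -/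

namespace LieGrading

variable {K : Type*} [Field K] {ι : Type*} [DecidableEq ι] {g : ι → Type*}
  [∀ i, LieRing (g i)] [∀ i, LieAlgebra K (g i)] (γ : ∀ i, LieGrading K (g i))

/-- The map on cohomology that is induced by the diagonal components of cocycles. -/
noncomputable def projHOne (ε : ℤˣ) (i : ι) :
    HOne K ((directSum γ).nilPart ε) (⨁ i, g i) →ₗ[K] HOne K ((γ i).nilPart ε) (g i) :=
  Submodule.mapQ _ _
    ((componentCochain γ ε i i).restrict fun _ hf => componentCochain_mem_ZOne hf i)
    fun _ hf => componentCochain_mem_BOne hf i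

theorem componentCochain_subtype_eq_zero (ε : ℤˣ) {i j : ι} (hij : i ≠ j) :
    (BOne K ((directSum γ).nilPart ε) (⨁ i, g i)).comap
        (ZOne K ((directSum γ).nilPart ε) (⨁ i, g i)).subtype ≤
      LinearMap.ker (componentCochain γ ε i j ∘ₗ
        (ZOne K ((directSum γ).nilPart ε) (⨁ i, g i)).subtype) := fun F hF => by
  rw [LinearMap.mem_ker, LinearMap.comp_apply]
  exact componentCochain_eq_zero_of_mem_BOne hij hF

/-- The off-diagonal components of a cohomology class. -/
noncomputable def offDiagonal (ε : ℤˣ) {i j : ι} (hij : i ≠ j) :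
    HOne K ((directSum γ).nilPart ε) (⨁ i, g i) →ₗ[K] oneCochain K ((γ j).nilPart ε) (g i) :=
  Submodule.liftQ _ _ (componentCochain_subtype_eq_zero γ ε hij)

variable {γ} {ε : ℤˣ}

theorem projHOne_cls (i : ι) {F : oneCochain K ((directSum γ).nilPart ε) (⨁ i, g i)}
    (hF : F ∈ ZOne K ((directSum γ).nilPart ε) (⨁ i, g i)) : projHOne γ ε i (cls F hF) =
      cls (componentCochain γ ε i i F) (componentCochain_mem_ZOne hF i) := rfl

theorem offDiagonal_cls {i j : ι} (hij : i ≠ j)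
    {F : oneCochain K ((directSum γ).nilPart ε) (⨁ i, g i)}
    (hF : F ∈ ZOne K ((directSum γ).nilPart ε) (⨁ i, g i)) :
    offDiagonal γ ε hij (cls F hF) = componentCochain γ ε i j F := rfl

theorem extendHOne_cls {i : ι} {f : oneCochain K ((γ i).nilPart ε) (g i)}
    (hf : f ∈ ZOne K ((γ i).nilPart ε) (g i)) :
    extendHOne γ ε i (cls f hf) =
      cls (extendCochain γ ε i f) (extendCochain_mem_ZOne γ ε i hf) := rfl

end LieGrading

section Cls

variable {R L M : Type*} [CommRing R] [LieRing L] [LieAlgebra R L]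
  [AddCommGroup M] [Module R M] [LieRingModule L M] [LieModule R L M]

theorem exists_cls_eq (c : HOne R L M) : ∃ f, ∃ hf : f ∈ ZOne R L M, cls f hf = c := by
  obtain ⟨⟨f, hf⟩, h⟩ := Submodule.Quotient.mk_surjective _ c
  exact ⟨f, hf, h⟩

theorem cls_eq_zero_iff {f : oneCochain R L M} (hf : f ∈ ZOne R L M) :
    cls f hf = 0 ↔ f ∈ BOne R L M :=
  Submodule.Quotient.mk_eq_zero _

theorem cls_congr {f f' : oneCochain R L M} (h : f = f') (hf : f ∈ ZOne R L M)
    (hf' : f' ∈ ZOne R L M) : cls f hf = cls f' hf' := by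
  subst h; rfl

end Cls

namespace LieGrading

variable {K : Type*} [Field K] {ι : Type*} [DecidableEq ι] {g : ι → Type*}
  [∀ i, LieRing (g i)] [∀ i, LieAlgebra K (g i)] {γ : ∀ i, LieGrading K (g i)} {ε : ℤˣ}

theorem cls_mem_homogeneousHOne {L : Type*} [LieRing L] [LieAlgebra K L] {γ : LieGrading K L}
    {l : ℤ} {f : oneCochain K (γ.nilPart ε) L} (hf : f ∈ ZOne K (γ.nilPart ε) L)
    (h : ∀ (m : ℤ) (x : γ.nilPart ε), (x : L) ∈ γ.piece m → f x ∈ γ.piece (m + l)) :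
    cls f hf ∈ γ.homogeneousHOne ε l :=
  Submodule.mem_map_of_mem (f := Submodule.mkQ _) (show ⟨f, hf⟩ ∈ γ.homogeneousZOne ε l from h)

theorem exists_cls_eq_of_mem_homogeneousHOne {L : Type*} [LieRing L] [LieAlgebra K L]
    {γ : LieGrading K L} {l : ℤ} {c : HOne K (γ.nilPart ε) L}
    (hc : c ∈ γ.homogeneousHOne ε l) : ∃ f, ∃ hf : f ∈ ZOne K (γ.nilPart ε) L, cls f hf = c ∧
      ∀ (m : ℤ) (x : γ.nilPart ε), (x : L) ∈ γ.piece m → f x ∈ γ.piece (m + l) := by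
  obtain ⟨⟨f, hf⟩, h, h'⟩ := hc
  exact ⟨f, hf, h', h⟩

theorem projHOne_extendHOne_same (i : ι) (c : HOne K ((γ i).nilPart ε) (g i)) :
    projHOne γ ε i (extendHOne γ ε i c) = c := by
  obtain ⟨f, hf, rfl⟩ := exists_cls_eq c
  rw [extendHOne_cls, projHOne_cls]
  exact cls_congr (componentCochain_extendCochain_same γ f) _ _

theorem projHOne_extendHOne_of_ne (i k : ι) (hik : i ≠ k) (c : HOne K ((γ k).nilPart ε) (g k)) :
    projHOne γ ε i (extendHOne γ ε k c) = 0 := by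
  obtain ⟨f, hf, rfl⟩ := exists_cls_eq c
  rw [extendHOne_cls, projHOne_cls, cls_eq_zero_iff,
    componentCochain_extendCochain_of_ne γ (.inl hik)]
  exact zero_mem _

theorem offDiagonal_extendHOne {i j : ι} (hij : i ≠ j) (k : ι)
    (c : HOne K ((γ k).nilPart ε) (g k)) :
    offDiagonal γ ε hij (extendHOne γ ε k c) = 0 := by
  obtain ⟨f, hf, rfl⟩ := exists_cls_eq c
  rw [extendHOne_cls, offDiagonal_cls]
  refine componentCochain_extendCochain_of_ne γ ?_ f
  by_contra! h
  exact hij (h.1.trans h.2.symm)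

theorem eq_zero_of_projHOne_of_offDiagonal [Fintype ι]
    (c : HOne K ((directSum γ).nilPart ε) (⨁ i, g i)) (h : ∀ i, projHOne γ ε i c = 0)
    (h' : ∀ p : {p : ι × ι // p.1 ≠ p.2}, offDiagonal γ ε p.2 c = 0) : c = 0 := by
  obtain ⟨F, hF, rfl⟩ := exists_cls_eq c
  simp only [projHOne_cls, cls_eq_zero_iff] at h
  -- As the family is finite, the primitives of the diagonal components assemble into one element of
  -- the direct sum, and its coboundary has no off-diagonal part to correct.
  choose m hm using h
  rw [cls_eq_zero_iff]
  have hB : dZero K ((directSum γ).nilPart ε) (⨁ i, g i) (DFinsupp.equivFunOnFintype.symm m) ∈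
    BOne K ((directSum γ).nilPart ε) (⨁ i, g i) := ⟨_, rfl⟩
  convert hB
  refine componentCochain_ext γ fun i j => ?_
  by_cases hij : i = j
  · subst hij
    rw [← hm i]
    refine LinearMap.ext fun y => ?_
    rw [componentCochain_apply, dZero_apply, dZero_apply, LieSubalgebra.coe_bracket_of_module,
      LieSubalgebra.coe_bracket_of_module, DirectSum.bracket_apply, coe_nilIncl,
      DirectSum.of_eq_same]
    rfl
  · rw [componentCochain_eq_zero_of_mem_BOne hij hB]
    exact h' ⟨(i, j), hij⟩

theorem ext_projHOne_offDiagonal [Fintype ι]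
    (c c' : HOne K ((directSum γ).nilPart ε) (⨁ i, g i))
    (h : ∀ i, projHOne γ ε i c = projHOne γ ε i c')
    (h' : ∀ p : {p : ι × ι // p.1 ≠ p.2}, offDiagonal γ ε p.2 c = offDiagonal γ ε p.2 c') :
    c = c' :=
  sub_eq_zero.1 <| eq_zero_of_projHOne_of_offDiagonal _
    (fun i => by rw [map_sub, h, sub_self]) fun p => by rw [map_sub, h', sub_self]

theorem extendHOne_mem_homogeneousHOne {i : ι} {l : ℤ} {c : HOne K ((γ i).nilPart ε) (g i)}
    (hc : c ∈ (γ i).homogeneousHOne ε l) :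
    extendHOne γ ε i c ∈ (directSum γ).homogeneousHOne ε l := by
  obtain ⟨f, hf, rfl, h⟩ := exists_cls_eq_of_mem_homogeneousHOne hc
  rw [extendHOne_cls]
  exact cls_mem_homogeneousHOne _ fun m x hx =>
    of_mem_directSum_piece γ (h m (nilProj γ ε i x) (hx i))

theorem projHOne_mem_homogeneousHOne (i : ι) {l : ℤ}
    {c : HOne K ((directSum γ).nilPart ε) (⨁ i, g i)}
    (hc : c ∈ (directSum γ).homogeneousHOne ε l) :
    projHOne γ ε i c ∈ (γ i).homogeneousHOne ε l := by
  obtain ⟨F, hF, rfl, h⟩ := exists_cls_eq_of_mem_homogeneousHOne hc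
  rw [projHOne_cls]
  exact cls_mem_homogeneousHOne _ fun m x hx =>
    h m (nilIncl γ ε i x) (of_mem_directSum_piece γ hx) i

/-! ### Cross classes and the decomposition of `H¹` -/

section KGraded

variable (hγ : ∀ i, (γ i).IsKGraded 2) [∀ i, FiniteDimensional K (g i)]
include hγ

/-- The class of the tensor `x ⊗ z`. -/
noncomputable def crossHOne (ε : ℤˣ) (p : {p : ι × ι // p.1 ≠ p.2}) :
    ((γ p.1.1).piece (2 * ε) ⊗[K] (γ p.1.2).piece (-ε)) →ₗ[K]
      HOne K ((directSum γ).nilPart ε) (⨁ i, g i) :=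
  Submodule.mkQ _ ∘ₗ crossMap hγ ε p.1.1 p.1.2

theorem crossHOne_apply (p : {p : ι × ι // p.1 ≠ p.2})
    (t : (γ p.1.1).piece (2 * ε) ⊗[K] (γ p.1.2).piece (-ε)) :
    crossHOne hγ ε p t =
      cls (crossMap hγ ε p.1.1 p.1.2 t).1 (crossMap hγ ε p.1.1 p.1.2 t).2 := rfl

theorem crossHOne_mem_homogeneousHOne (p : {p : ι × ι // p.1 ≠ p.2})
    (t : (γ p.1.1).piece (2 * ε) ⊗[K] (γ p.1.2).piece (-ε)) :
    crossHOne hγ ε p t ∈ (directSum γ).homogeneousHOne ε ε :=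
  cls_mem_homogeneousHOne _ (crossMap_mem_homogeneousZOne hγ t)

theorem projHOne_crossHOne (i : ι) (p : {p : ι × ι // p.1 ≠ p.2})
    (t : (γ p.1.1).piece (2 * ε) ⊗[K] (γ p.1.2).piece (-ε)) :
    projHOne γ ε i (crossHOne hγ ε p t) = 0 := by
  rw [crossHOne_apply, projHOne_cls, cls_eq_zero_iff, componentCochain_crossMap_of_ne hγ]
  · exact zero_mem _
  · by_contra! h
    exact p.2 (h.1.symm.trans h.2)

theorem offDiagonal_crossHOne_of_ne (p q : {p : ι × ι // p.1 ≠ p.2}) (hpq : p ≠ q)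
    (t : (γ q.1.1).piece (2 * ε) ⊗[K] (γ q.1.2).piece (-ε)) :
    offDiagonal γ ε p.2 (crossHOne hγ ε q t) = 0 := by
  rw [crossHOne_apply, offDiagonal_cls]
  refine componentCochain_crossMap_of_ne hγ ?_ t
  by_contra! h
  exact hpq (Subtype.ext (Prod.ext h.1 h.2))

variable [CharZero K] [∀ i, LieAlgebra.IsSemisimple K (g i)]

theorem offDiagonal_crossHOne_injective (p : {p : ι × ι // p.1 ≠ p.2})
    (t t' : (γ p.1.1).piece (2 * ε) ⊗[K] (γ p.1.2).piece (-ε))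
    (h : offDiagonal γ ε p.2 (crossHOne hγ ε p t) = offDiagonal γ ε p.2 (crossHOne hγ ε p t')) :
    t = t' :=
  sub_eq_zero.1 <| eq_zero_of_componentCochain_crossMap hγ <| by
    rw [map_sub, Submodule.coe_sub, map_sub]
    exact sub_eq_zero.2 h

theorem exists_offDiagonal_crossHOne_eq (p : {p : ι × ι // p.1 ≠ p.2})
    (c : HOne K ((directSum γ).nilPart ε) (⨁ i, g i)) :
    ∃ t, offDiagonal γ ε p.2 (crossHOne hγ ε p t) = offDiagonal γ ε p.2 c := by
  obtain ⟨F, hF, rfl⟩ := exists_cls_eq c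
  exact exists_componentCochain_crossMap_eq hγ p.2 hF

theorem offDiagonal_eq_zero_of_mem_homogeneousHOne (p : {p : ι × ι // p.1 ≠ p.2}) {l : ℤ}
    (hl : l ≠ ε) {c : HOne K ((directSum γ).nilPart ε) (⨁ i, g i)}
    (hc : c ∈ (directSum γ).homogeneousHOne ε l) : offDiagonal γ ε p.2 c = 0 := by
  obtain ⟨F, hF, rfl, h⟩ := exists_cls_eq_of_mem_homogeneousHOne hc
  exact componentCochain_eq_zero_of_homogeneous hγ p.2 hl (F := ⟨F, hF⟩) h

theorem sumHOne_coprod_bijective [Fintype ι] (ε : ℤˣ) : Function.Bijective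
    (LinearMap.coprod (sumHOne γ ε) (DirectSum.toModule K _ _ (crossHOne hγ ε))) :=
  ⟨coprod_toModule_injective (E := extendHOne γ ε) (π := projHOne γ ε)
      (ρ := fun p : {p : ι × ι // p.1 ≠ p.2} => offDiagonal γ ε p.2)
      (T := crossHOne hγ ε) projHOne_extendHOne_same projHOne_extendHOne_of_ne
      (projHOne_crossHOne hγ) (fun p => offDiagonal_extendHOne p.2)
      (offDiagonal_crossHOne_of_ne hγ) (offDiagonal_crossHOne_injective hγ),
    coprod_toModule_surjective (E := extendHOne γ ε) (π := projHOne γ ε)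
      (ρ := fun p : {p : ι × ι // p.1 ≠ p.2} => offDiagonal γ ε p.2)
      (T := crossHOne hγ ε) projHOne_extendHOne_same projHOne_extendHOne_of_ne
      (projHOne_crossHOne hγ) (fun p => offDiagonal_extendHOne p.2)
      (offDiagonal_crossHOne_of_ne hγ) (exists_offDiagonal_crossHOne_eq hγ)
      ext_projHOne_offDiagonal⟩

/-- Injectivity comes from the retractions `projHOne` and needs no homogeneity; `hl` enters in
surjectivity, where it kills the off-diagonal parts. Both natural maps preserve homogeneity. -/
theorem bijOn_sumHOne [Fintype ι] {ε : ℤˣ} {l : ℤ} (hl : l ≠ ε) :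
    Set.BijOn (sumHOne γ ε) {c | ∀ i, c i ∈ (γ i).homogeneousHOne ε l}
      ((directSum γ).homogeneousHOne ε l) := by
  refine ⟨fun c hc => toModule_mem fun i => extendHOne_mem_homogeneousHOne (hc i),
    fun c _ c' _ h => DFinsupp.ext fun i => ?_, fun h hh => ?_⟩
  · have h1 := toModule_retract (E := extendHOne γ ε) (π := projHOne γ ε) projHOne_extendHOne_same
      projHOne_extendHOne_of_ne i
    exact (h1 c).symm.trans ((congrArg (projHOne γ ε i) h).trans (h1 c'))
  · obtain ⟨c, hc, hch⟩ := exists_toModule_eq (E := extendHOne γ ε) (π := projHOne γ ε)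
      (ρ := fun p : {p : ι × ι // p.1 ≠ p.2} => offDiagonal γ ε p.2)
      projHOne_extendHOne_same projHOne_extendHOne_of_ne
      (fun p : {p : ι × ι // p.1 ≠ p.2} => offDiagonal_extendHOne p.2)
      ext_projHOne_offDiagonal
      fun p => offDiagonal_eq_zero_of_mem_homogeneousHOne hγ p hl hh
    refine ⟨c, fun i => ?_, hch⟩
    rw [hc i]
    exact projHOne_mem_homogeneousHOne i hh

end KGraded

end LieGrading

end LieHOne

theorem mainTheorem6 {K : Type*} [Field K] [CharZero K]
    {ι : Type*} [Fintype ι] [DecidableEq ι] (g : ι → Type*)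
    [∀ i, LieRing (g i)] [∀ i, LieAlgebra K (g i)] [∀ i, FiniteDimensional K (g i)]
    [∀ i, LieAlgebra.IsSemisimple K (g i)]
    (γ : ∀ i, LieGrading K (g i)) (hγ : ∀ i, (γ i).IsKGraded 2) (ε : ℤˣ) :
    -- In every homogeneity other than `ε`, in particular in homogeneity zero, the natural map
    -- from the direct sum is bijective.
    (∀ l : ℤ, l ≠ ε →
      Set.BijOn (LieGrading.sumHOne γ ε)
        {c | ∀ i, c i ∈ (γ i).homogeneousHOne ε l}
        ((LieGrading.directSum γ).homogeneousHOne ε l)) ∧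
    -- The full first cohomology, with the cross terms, which all have homogeneity `ε`.
    ∃ T : ∀ p : {p : ι × ι // p.1 ≠ p.2},
        ((γ p.1.1).piece (2 * ε) ⊗[K] (γ p.1.2).piece (-ε)) →ₗ[K]
          HOne K ((LieGrading.directSum γ).nilPart ε) (⨁ i, g i),
      (∀ p (x : (γ p.1.1).piece (2 * ε)) (z : (γ p.1.2).piece (-ε)),
        ∃ h : LieGrading.crossCochain γ ε p.1.1 p.1.2 (x : g p.1.1) (z : g p.1.2) ∈
            ZOne K ((LieGrading.directSum γ).nilPart ε) (⨁ i, g i),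
          T p (x ⊗ₜ[K] z) = cls _ h) ∧
      (∀ p t, T p t ∈ (LieGrading.directSum γ).homogeneousHOne ε ε) ∧
      Function.Bijective
        (LinearMap.coprod (LieGrading.sumHOne γ ε) (DirectSum.toModule K _ _ T)) := by
  exact ⟨fun l hl => LieGrading.bijOn_sumHOne hγ hl, LieGrading.crossHOne hγ ε,
    fun p x z => ⟨LieGrading.crossCochain_mem_ZOne hγ x.2 z.2, rfl⟩,
    LieGrading.crossHOne_mem_homogeneousHOne hγ, LieGrading.sumHOne_coprod_bijective hγ ε⟩
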